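/- Let $p,\beta,\sigma,\epsilon>0$ be constants and let $\alpha,\gamma:\mathbb R\to\mathbb R$ be continuous, positive and $p$-periodic. Write $\bar b=\frac1p\int_0^p b(s)\,ds$. Consider the system $$x'=\alpha(t)-\beta\,\frac{x}{y},\qquad y'=-\gamma(t)+\sigma\,\frac{x}{y}+\frac{\epsilon}{y}.$$ A positive $p$-periodic solution $(x(t),y(t))$, $t\in\mathbb R$ (that is, $x(t)>0$ and $y(t)>0$ for all $t$), exists if and only if $$\beta\bar\gamma-\sigma\bar\alpha>0.$$ If this condition holds, the positive $p$-periodic solution $(x,y)$ is unique, and it attracts all other positive solutions as $t\to\infty$: for every $t_0\in\mathbb R$ and all $u_0,v_0>0$ there is a positive solution $(u,v)$ on $[t_0,\infty)$ with $u(t_0)=u_0$, $v(t_0)=v_0$, and every positive solution $(u,v)$ on $[t_0,\infty)$ satisfies $u(t)-x(t)\to0$ and $v(t)-y(t)\to0$ as $t\to\infty$. -/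

import Mathlib

open Set Filter Topology

noncomputable section

/-- The mean value of `b` over `[0, p]`. -/
def meanValue (p : ℝ) (b : ℝ → ℝ) : ℝ :=
  (1 / p) * ∫ t in (0 : ℝ)..p, b t

/-- `(x, y)` is a positive (classical) solution on the time set `J` of the system
`x' = α(t) - β x / y`, `y' = -γ(t) + σ x / y + ε / y`.
The derivatives at an endpoint belonging to `J` are one-sided. -/
structure IsPositiveSolutionOn (α γ : ℝ → ℝ) (β σ ε : ℝ) (J : Set ℝ) (x y : ℝ → ℝ) : Prop where
  pos_x : ∀ t ∈ J, 0 < x t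
  pos_y : ∀ t ∈ J, 0 < y t
  deriv_x : ∀ t ∈ J, HasDerivWithinAt x (α t - β * (x t / y t)) J t
  deriv_y : ∀ t ∈ J, HasDerivWithinAt y (-γ t + σ * (x t / y t) + ε / y t) J t

/-- `(x, y)` is a positive `p`-periodic solution of the system, on the whole time axis. -/
structure IsPositivePeriodicSolution (α γ : ℝ → ℝ) (β σ ε p : ℝ) (x y : ℝ → ℝ) : Prop where
  solution : IsPositiveSolutionOn α γ β σ ε univ x y
  periodic_x : Function.Periodic x p
  periodic_y : Function.Periodic y p

end

/-!
Integrating `σ x + β y`, whose derivative `β ε / y - (β γ - σ α)` is free of the interaction term,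
over one period shows that the condition is necessary.

Conversely, if the mean `δ` of `β γ - σ α` is positive and `G` is a bounded primitive of
`β γ - σ α - δ`, then `σ x + β y + G + 1 / (1 + y)` decreases wherever it is large, so every
positive solution is bounded. On bounded solutions the distance
`(σ + η) |x₁ - x₂| + β |y₁ - y₂|` decays exponentially for a small `η > 0`, which gives
attraction and uniqueness. Comparing a solution `x` with its translate `x (· + p)` in the same way
makes the sequence `x (· + n p)` converge; its limit is the periodic solution, bounded below because
`x` and `y` stay above a barrier determined by `inf α` and `sup γ`.
-/

section Periodic

variable {E : Type*} [NormedAddCommGroup E] {f g : ℝ → E} {p : ℝ}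

lemma tendsto_add_nat_mul_atTop (hp : 0 < p) (t : ℝ) :
    Tendsto (fun n : ℕ => t + n * p) atTop atTop :=
  tendsto_atTop_add_const_left _ _ (tendsto_natCast_atTop_atTop.atTop_mul_const hp)

lemma tendsto_comp_add_nat_mul_of_periodic (hp : 0 < p) (hg : Function.Periodic g p)
    (h : Tendsto (fun t => f t - g t) atTop (𝓝 0)) (t : ℝ) :
    Tendsto (fun n : ℕ => f (t + n * p)) atTop (𝓝 (g t)) := by
  simpa [hg.nat_mul _ t] using (h.comp (tendsto_add_nat_mul_atTop hp t)).add_const (g t)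

lemma mem_of_periodic_of_tendsto_sub {S : Set E} (hS : IsClosed S) (hp : 0 < p)
    (hg : Function.Periodic g p) (h : Tendsto (fun t => f t - g t) atTop (𝓝 0))
    (hf : ∀ᶠ t in atTop, f t ∈ S) (t : ℝ) : g t ∈ S :=
  hS.mem_of_tendsto (tendsto_comp_add_nat_mul_of_periodic hp hg h t)
    ((tendsto_add_nat_mul_atTop hp t).eventually hf)

lemma eq_of_periodic_of_tendsto_sub (hp : 0 < p) (hf : Function.Periodic f p)
    (hg : Function.Periodic g p) (h : Tendsto (fun t => f t - g t) atTop (𝓝 0)) : f = g := by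
  funext t
  have hlim := tendsto_comp_add_nat_mul_of_periodic hp hg h t
  simp only [hf.nat_mul _ t] at hlim
  exact tendsto_nhds_unique tendsto_const_nhds hlim

lemma tendsto_zero_of_norm_le_exp {C k a : ℝ} (hk : 0 < k)
    (hf : ∀ t ∈ Ici a, ‖f t‖ ≤ C * Real.exp (-k * (t - a))) : Tendsto f atTop (𝓝 0) := by
  have hexp : Tendsto (fun t => Real.exp (-k * (t - a))) atTop (𝓝 0) :=
    Real.tendsto_exp_atBot.comp <|
      (tendsto_atTop_add_const_right _ (-a) tendsto_id).const_mul_atTop_of_neg (neg_lt_zero.2 hk)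
  refine squeeze_zero_norm' ((eventually_ge_atTop a).mono hf) ?_
  simpa using hexp.const_mul C

lemma exists_periodic_tendsto_sub_of_exp_bound [CompleteSpace E] {C k : ℝ} (hp : 0 < p)
    (hk : 0 < k) (hf : ∀ t, 0 ≤ t → ‖f (t + p) - f t‖ ≤ C * Real.exp (-k * t)) :
    ∃ g : ℝ → E, Function.Periodic g p ∧ Tendsto (fun t => f t - g t) atTop (𝓝 0) := by
  have hr : Real.exp (-k * p) < 1 := Real.exp_lt_one_iff.2 (by nlinarith)
  have hgeom : ∀ t, 0 ≤ t → ∀ n : ℕ, dist (f (t + n * p)) (f (t + (n + 1 : ℕ) * p)) ≤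
      C * Real.exp (-k * t) * Real.exp (-k * p) ^ n := by
    intro t ht n
    have hnext : t + (n + 1 : ℕ) * p = t + n * p + p := by push_cast; ring
    have hexp : -k * t + n * (-k * p) = -k * (t + n * p) := by ring
    rw [dist_comm, dist_eq_norm, mul_assoc, ← Real.exp_nat_mul, ← Real.exp_add, hnext, hexp]
    exact hf (t + n * p) (by positivity)
  have hlim : ∀ t, ∃ l, Tendsto (fun n : ℕ => f (t + n * p)) atTop (𝓝 l) := by
    intro t
    obtain ⟨N, hN⟩ := exists_nat_gt (-t / p)
    have hN' : 0 ≤ t + N * p := by rw [div_lt_iff₀ hp] at hN; linarith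
    obtain ⟨l, hl⟩ := cauchySeq_tendsto_of_complete (cauchySeq_of_le_geometric _ _ hr (hgeom _ hN'))
    refine ⟨l, (tendsto_add_atTop_iff_nat N).1 (hl.congr fun n => ?_)⟩
    push_cast
    ring_nf
  choose g hg using hlim
  refine ⟨g, fun t => ?_, ?_⟩
  · refine tendsto_nhds_unique (hg (t + p)) (((tendsto_add_atTop_iff_nat 1).2 (hg t)).congr ?_)
    intro n
    push_cast
    ring_nf
  · refine tendsto_zero_of_norm_le_exp (a := 0) (C := C / (1 - Real.exp (-k * p))) hk fun t ht => ?_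
    rw [← dist_eq_norm, sub_zero, div_mul_eq_mul_div]
    simpa using dist_le_of_le_geometric_of_tendsto₀ _ _ hr (hgeom t ht) (hg t)

-- The translates `f (· + n * p)` and their derivatives converge locally uniformly to `g` and `g'`.
lemma hasDerivAt_of_periodic_of_tendsto_sub [NormedSpace ℝ E] {f' g' : ℝ → E} (hp : 0 < p)
    (hg : Function.Periodic g p) (hg' : Function.Periodic g' p)
    (hf : ∀ᶠ t in atTop, HasDerivAt f (f' t) t)
    (h : Tendsto (fun t => f t - g t) atTop (𝓝 0))
    (h' : Tendsto (fun t => f' t - g' t) atTop (𝓝 0)) (t : ℝ) : HasDerivAt g (g' t) t := by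
  have htop : Tendsto (fun q : ℕ × ℝ => q.2 + q.1 * p) (atTop ×ˢ 𝓝 t) atTop :=
    tendsto_snd.add_atTop ((tendsto_natCast_atTop_atTop.atTop_mul_const hp).comp tendsto_fst)
  refine hasDerivAt_of_tendstoUniformlyOnFilter (l := atTop)
    (f := fun (n : ℕ) s => f (s + n * p)) (f' := fun n s => f' (s + n * p)) ?_ ?_
    (.of_forall (tendsto_comp_add_nat_mul_of_periodic hp hg h))
  · rw [tendstoUniformlyOnFilter_iff_tendsto, tendsto_uniformity_iff_dist_tendsto_zero]
    refine (tendsto_zero_iff_norm_tendsto_zero.1 (h'.comp htop)).congr fun q => ?_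
    simp [dist_comm (g' q.2), dist_eq_norm, hg'.nat_mul _ q.2]
  · exact (htop.eventually hf).mono fun q hq => hq.comp_add_const _ _

end Periodic

section RealPeriodic

variable {b : ℝ → ℝ} {p : ℝ}

lemma exists_pos_le_of_periodic (hp : 0 < p) (hb : Continuous b) (hbp : Function.Periodic b p)
    (hpos : ∀ t, 0 < b t) : ∃ c, 0 < c ∧ ∀ t, c ≤ b t := by
  obtain ⟨_, ⟨s, rfl⟩, hs⟩ :=
    (hbp.compact_of_continuous hp.ne' hb).exists_isLeast (range_nonempty b)
  exact ⟨b s, hpos s, fun t => hs (mem_range_self t)⟩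

lemma exists_pos_abs_le_of_periodic (hp : 0 < p) (hb : Continuous b)
    (hbp : Function.Periodic b p) : ∃ A, 0 < A ∧ ∀ t, |b t| ≤ A := by
  obtain ⟨A, hA, hbA⟩ := (hbp.isBounded_of_continuous hp.ne' hb).exists_pos_norm_le
  exact ⟨A, hA, fun t => hbA _ (mem_range_self t)⟩

lemma exists_bounded_primitive_sub_meanValue (hp : 0 < p) (hb : Continuous b)
    (hbp : Function.Periodic b p) :
    ∃ G : ℝ → ℝ, (∀ t, HasDerivAt G (b t - meanValue p b) t) ∧ ∃ C, ∀ t, |G t| ≤ C := by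
  set g : ℝ → ℝ := fun t => b t - meanValue p b
  have hg : Continuous g := hb.sub continuous_const
  have hG : ∀ t, HasDerivAt (fun t => ∫ s in (0 : ℝ)..t, g s) (g t) t := fun t =>
    (hg.integral_hasStrictDerivAt 0 t).hasDerivAt
  have hmean : ∫ t in (0 : ℝ)..p, g t = 0 := by
    rw [intervalIntegral.integral_sub (hb.intervalIntegrable _ _) intervalIntegrable_const,
      intervalIntegral.integral_const, smul_eq_mul, sub_zero, meanValue]
    field_simp
    ring
  have hper : Function.Periodic (fun t => ∫ s in (0 : ℝ)..t, g s) p := fun t => by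
    have hgp : Function.Periodic g p := fun s => by simp only [g, hbp s]
    have hshift := hgp.intervalIntegral_add_eq t 0
    rw [zero_add, hmean] at hshift
    beta_reduce
    rw [← intervalIntegral.integral_add_adjacent_intervals (hg.intervalIntegrable 0 t)
      (hg.intervalIntegrable t (t + p)), hshift, add_zero]
  obtain ⟨C, -, hC⟩ := exists_pos_abs_le_of_periodic hp
    (continuous_iff_continuousAt.2 fun t => (hG t).continuousAt) hper
  exact ⟨_, hG, C, hC⟩

lemma mul_meanValue_sub_mul_meanValue {c : ℝ → ℝ}
    (hb : IntervalIntegrable b MeasureTheory.volume 0 p)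
    (hc : IntervalIntegrable c MeasureTheory.volume 0 p) (r s : ℝ) :
    r * meanValue p b - s * meanValue p c = meanValue p fun t => r * b t - s * c t := by
  simp only [meanValue]
  rw [intervalIntegral.integral_sub (hb.const_mul r) (hc.const_mul s),
    intervalIntegral.integral_const_mul, intervalIntegral.integral_const_mul]
  ring

end RealPeriodic

section Comparison

variable {f f' : ℝ → ℝ} {a b : ℝ}

lemma exists_abs_le_one_hasDerivWithinAt_abs {d t : ℝ} (h : HasDerivWithinAt f d (Ici t) t) :
    ∃ s : ℝ, |s| ≤ 1 ∧ s * f t = |f t| ∧ HasDerivWithinAt (fun r => |f r|) (s * d) (Ici t) t := by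
  rcases lt_trichotomy (f t) 0 with hneg | hzero | hpos
  · exact ⟨-1, by simp, by simp [abs_of_neg hneg],
      (hasDerivAt_abs_neg hneg).comp_hasDerivWithinAt t h⟩
  · have habs : HasDerivWithinAt (fun r => |f r|) |d| (Ici t) t := by
      rw [hasDerivWithinAt_iff_tendsto_slope, Ici_sdiff_left] at h ⊢
      refine h.abs.congr' ?_
      filter_upwards [self_mem_nhdsWithin] with r hr
      simp [slope_def_field, hzero, abs_div, abs_of_pos (sub_pos.2 (mem_Ioi.1 hr))]
    rcases abs_choice d with hd | hd
    · exact ⟨1, by simp, by simp [hzero], by simpa [hd] using habs⟩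
    · exact ⟨-1, by simp, by simp [hzero], by simpa [hd] using habs⟩
  · exact ⟨1, by simp, by simp [abs_of_pos hpos],
      (hasDerivAt_abs_pos hpos).comp_hasDerivWithinAt t h⟩

lemma le_of_hasDerivWithinAt_neg_of_eq {m : ℝ}
    (hf : ∀ t ∈ Icc a b, HasDerivWithinAt f (f' t) (Icc a b) t) (ha : f a ≤ m)
    (h : ∀ t ∈ Icc a b, f t = m → f' t < 0) : ∀ t ∈ Icc a b, f t ≤ m :=
  image_le_of_deriv_right_lt_deriv_boundary (B := fun _ => m) (B' := 0)
    (fun t ht => (hf t ht).continuousWithinAt)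
    (fun t ht => (hf t (Ico_subset_Icc_self ht)).mono_of_mem_nhdsWithin
      (Icc_mem_nhdsGE_of_mem ht))
    ha (fun t => hasDerivAt_const t m) (fun t ht => h t (Ico_subset_Icc_self ht))

lemma le_of_hasDerivWithinAt_pos_of_eq {m : ℝ}
    (hf : ∀ t ∈ Icc a b, HasDerivWithinAt f (f' t) (Icc a b) t) (ha : m ≤ f a)
    (h : ∀ t ∈ Icc a b, f t = m → 0 < f' t) : ∀ t ∈ Icc a b, m ≤ f t := fun t ht =>
  neg_le_neg_iff.1 <| le_of_hasDerivWithinAt_neg_of_eq (fun s hs => (hf s hs).neg)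
    (neg_le_neg ha) (fun s hs e => neg_lt_zero.2 (h s hs (neg_injective e))) t ht

lemma le_add_mul_sub_of_hasDerivWithinAt_le {A : ℝ}
    (hf : ∀ t ∈ Icc a b, HasDerivWithinAt f (f' t) (Icc a b) t) (h : ∀ t ∈ Icc a b, f' t ≤ A) :
    ∀ t ∈ Icc a b, f t ≤ f a + A * (t - a) :=
  image_le_of_deriv_right_le_deriv_boundary (B' := fun _ => A)
    (fun t ht => (hf t ht).continuousWithinAt)
    (fun t ht => (hf t (Ico_subset_Icc_self ht)).mono_of_mem_nhdsWithin
      (Icc_mem_nhdsGE_of_mem ht))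
    (by simp) (by fun_prop)
    (fun t _ => by
      simpa using (((hasDerivWithinAt_id t _).sub_const a).const_mul A).const_add (f a))
    (fun t ht => h t (Ico_subset_Icc_self ht))

lemma exists_hasDerivWithinAt_forcing_add {E : Type*} [NormedAddCommGroup E] [NormedSpace ℝ E]
    [CompleteSpace E] {h : ℝ → E} {V : E → E} {K : NNReal} {L : ℝ} (hab : a ≤ b)
    (hh : ContinuousOn h (Icc a b)) (hV : LipschitzWith K V) (hVL : ∀ z, ‖V z‖ ≤ L) (z₀ : E) :
    ∃ z : ℝ → E, z a = z₀ ∧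
      ∀ t ∈ Icc a b, HasDerivWithinAt z (h t + V (z t)) (Icc a b) t := by
  obtain ⟨C, hC⟩ := isCompact_Icc.exists_bound_of_continuousOn hh
  have hPL : IsPicardLindelof (fun t z => h t + V z) (⟨a, le_rfl, hab⟩ : Icc a b) z₀
      ((C + L).toNNReal * ⟨b - a, sub_nonneg.2 hab⟩) 0 (C + L).toNNReal K :=
    { lipschitzOnWith := fun t _ => by
        simpa using ((LipschitzWith.const (h t)).add hV).lipschitzOnWith
      continuousOn := fun z _ => hh.add continuousOn_const
      norm_le := fun t ht z _ =>
        ((norm_add_le _ _).trans (add_le_add (hC t ht) (hVL z))).trans (Real.le_coe_toNNReal _)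
      mul_max_le := by
        rw [max_eq_left (by simpa using hab)]
        exact (sub_zero _).ge }
  exact hPL.exists_eq_forall_mem_Icc_hasDerivWithinAt₀

end Comparison

namespace IsPositiveSolutionOn

variable {α γ : ℝ → ℝ} {β σ ε a b : ℝ} {J K : Set ℝ} {x y : ℝ → ℝ}

lemma mono (h : IsPositiveSolutionOn α γ β σ ε J x y) (hK : K ⊆ J) :
    IsPositiveSolutionOn α γ β σ ε K x y where
  pos_x t ht := h.pos_x t (hK ht)
  pos_y t ht := h.pos_y t (hK ht)
  deriv_x t ht := (h.deriv_x t (hK ht)).mono hK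
  deriv_y t ht := (h.deriv_y t (hK ht)).mono hK

lemma congr {u v : ℝ → ℝ} (h : IsPositiveSolutionOn α γ β σ ε J x y)
    (hu : EqOn u x J) (hv : EqOn v y J) : IsPositiveSolutionOn α γ β σ ε J u v where
  pos_x t ht := hu ht ▸ h.pos_x t ht
  pos_y t ht := hv ht ▸ h.pos_y t ht
  deriv_x t ht := by simpa only [hu ht, hv ht] using (h.deriv_x t ht).congr hu (hu ht)
  deriv_y t ht := by simpa only [hu ht, hv ht] using (h.deriv_y t ht).congr hv (hv ht)

lemma comp_add_const {c : ℝ} (h : IsPositiveSolutionOn α γ β σ ε J x y)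
    (hα : Function.Periodic α c) (hγ : Function.Periodic γ c) (hK : MapsTo (· + c) K J) :
    IsPositiveSolutionOn α γ β σ ε K (fun t => x (t + c)) (fun t => y (t + c)) where
  pos_x t ht := h.pos_x _ (hK ht)
  pos_y t ht := h.pos_y _ (hK ht)
  deriv_x t ht := by
    simpa only [Function.comp_def, id_eq, hα t, mul_one] using
      (h.deriv_x _ (hK ht)).comp t ((hasDerivWithinAt_id t K).add_const c) hK
  deriv_y t ht := by
    simpa only [Function.comp_def, id_eq, hγ t, mul_one] using
      (h.deriv_y _ (hK ht)).comp t ((hasDerivWithinAt_id t K).add_const c) hK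

lemma Ici_of_forall_Icc (h : ∀ b, a ≤ b → IsPositiveSolutionOn α γ β σ ε (Icc a b) x y) :
    IsPositiveSolutionOn α γ β σ ε (Ici a) x y := by
  have hmem : ∀ t ∈ Ici a, t ∈ Icc a (t + 1) := fun t ht => ⟨ht, (lt_add_one t).le⟩
  have hnhds : ∀ t, Icc a (t + 1) ∈ 𝓝[Ici a] t := fun t => by
    rw [← Ici_inter_Iic]
    exact inter_mem_nhdsWithin _ (Iic_mem_nhds (lt_add_one t))
  have hsol : ∀ t ∈ Ici a, IsPositiveSolutionOn α γ β σ ε (Icc a (t + 1)) x y := fun t ht =>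
    h _ ((mem_Ici.1 ht).trans (lt_add_one t).le)
  exact ⟨fun t ht => (hsol t ht).pos_x t (hmem t ht), fun t ht => (hsol t ht).pos_y t (hmem t ht),
    fun t ht => ((hsol t ht).deriv_x t (hmem t ht)).mono_of_mem_nhdsWithin (hnhds t),
    fun t ht => ((hsol t ht).deriv_y t (hmem t ht)).mono_of_mem_nhdsWithin (hnhds t)⟩

lemma continuousOn_x (h : IsPositiveSolutionOn α γ β σ ε J x y) : ContinuousOn x J :=
  fun t ht => (h.deriv_x t ht).continuousWithinAt

lemma continuousOn_y (h : IsPositiveSolutionOn α γ β σ ε J x y) : ContinuousOn y J :=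
  fun t ht => (h.deriv_y t ht).continuousWithinAt

-- The weights `σ` and `β` cancel the interaction term `x / y`.
lemma hasDerivWithinAt_mul_add_mul (h : IsPositiveSolutionOn α γ β σ ε J x y) {t : ℝ}
    (ht : t ∈ J) :
    HasDerivWithinAt (fun t => σ * x t + β * y t)
      (β * (ε / y t) - (β * γ t - σ * α t)) J t :=
  (((h.deriv_x t ht).const_mul σ).add ((h.deriv_y t ht).const_mul β)).congr_deriv (by ring)

end IsPositiveSolutionOn

section Contraction

lemma abs_div_sub_div_le {M m x₁ y₁ x₂ y₂ : ℝ} (hm : 0 < m) (hy₁ : m ≤ y₁) (hy₂ : m ≤ y₂)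
    (hx₂ : |x₂| ≤ M) :
    |x₁ / y₁ - x₂ / y₂| ≤ |x₁ - x₂| / m + M / m ^ 2 * |y₁ - y₂| := by
  have hy₁' : 0 < y₁ := hm.trans_le hy₁
  have hy₂' : 0 < y₂ := hm.trans_le hy₂
  have hM : 0 ≤ M := (abs_nonneg x₂).trans hx₂
  calc |x₁ / y₁ - x₂ / y₂| = |(x₁ - x₂) / y₁ - x₂ / (y₁ * y₂) * (y₁ - y₂)| := by
        congr 1
        field_simp
        ring
    _ ≤ |x₁ - x₂| / y₁ + |x₂| / (y₁ * y₂) * |y₁ - y₂| := by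
        refine (abs_sub _ _).trans_eq ?_
        rw [abs_mul, abs_div, abs_div, abs_of_pos hy₁', abs_of_pos (mul_pos hy₁' hy₂')]
    _ ≤ |x₁ - x₂| / m + M / m ^ 2 * |y₁ - y₂| := by
        rw [sq]
        gcongr

-- Only the off-diagonal contributions `s₁ * (y₁ - y₂)` and `s₂ * (x₁ - x₂)` need an estimate.
lemma weighted_drift_le {β σ ε η x₁ y₁ x₂ y₂ s₁ s₂ : ℝ} (hβ : 0 ≤ β) (hσ : 0 ≤ σ) (hη : 0 ≤ η)
    (hy₁ : 0 < y₁) (hx₂ : 0 ≤ x₂) (hy₂ : 0 < y₂) (hs₁ : |s₁| ≤ 1) (hs₂ : |s₂| ≤ 1)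
    (hX : s₁ * (x₁ - x₂) = |x₁ - x₂|) (hY : s₂ * (y₁ - y₂) = |y₁ - y₂|) :
    (σ + η) * (s₁ * -(β * (x₁ / y₁ - x₂ / y₂))) +
      β * (s₂ * (σ * (x₁ / y₁ - x₂ / y₂) + (ε / y₁ - ε / y₂))) ≤
      -(β * η / y₁ * |x₁ - x₂| + β * ((ε - η * x₂) / (y₁ * y₂)) * |y₁ - y₂|) := by
  have le_abs_of_mul : ∀ {s z : ℝ}, |s| ≤ 1 → s * z ≤ |z| := fun {s z} hs =>
    (le_abs_self _).trans <| abs_mul s z ▸ mul_le_of_le_one_left (abs_nonneg z) hs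
  have hoff₁ : (σ + η) * β * (x₂ / (y₁ * y₂)) * (s₁ * (y₁ - y₂)) ≤
      (σ + η) * β * (x₂ / (y₁ * y₂)) * |y₁ - y₂| :=
    mul_le_mul_of_nonneg_left (le_abs_of_mul hs₁) (by positivity)
  have hoff₂ : β * σ * (1 / y₁) * (s₂ * (x₁ - x₂)) ≤ β * σ * (1 / y₁) * |x₁ - x₂| :=
    mul_le_mul_of_nonneg_left (le_abs_of_mul hs₂) (by positivity)
  have hq : x₁ / y₁ - x₂ / y₂ = 1 / y₁ * (x₁ - x₂) - x₂ / (y₁ * y₂) * (y₁ - y₂) := by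
    field_simp
    ring
  have hε : ε / y₁ - ε / y₂ = -(ε / (y₁ * y₂) * (y₁ - y₂)) := by
    field_simp
    ring
  rw [hq, hε]
  calc _ = -((σ + η) * β * (1 / y₁) * (s₁ * (x₁ - x₂))) +
          (σ + η) * β * (x₂ / (y₁ * y₂)) * (s₁ * (y₁ - y₂)) +
          β * σ * (1 / y₁) * (s₂ * (x₁ - x₂)) -
          (β * σ * (x₂ / (y₁ * y₂)) + β * (ε / (y₁ * y₂))) * (s₂ * (y₁ - y₂)) := by ring
    _ ≤ -((σ + η) * β * (1 / y₁) * |x₁ - x₂|) + (σ + η) * β * (x₂ / (y₁ * y₂)) * |y₁ - y₂| +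
          β * σ * (1 / y₁) * |x₁ - x₂| -
          (β * σ * (x₂ / (y₁ * y₂)) + β * (ε / (y₁ * y₂))) * |y₁ - y₂| := by
        rw [hX, hY]
        gcongr
    _ = _ := by ring

-- The additional weight `η` turns the weak contraction of `η = 0` into a strict one.
lemma exists_pos_rate {β σ ε M : ℝ} (hβ : 0 < β) (hσ : 0 ≤ σ) (hε : 0 < ε) (hM : 0 < M) :
    ∃ η k : ℝ, 0 < η ∧ 0 < k ∧ (∀ y, 0 < y → y ≤ M → k * (σ + η) ≤ β * η / y) ∧
      ∀ x y₁ y₂, x ≤ M → 0 < y₁ → y₁ ≤ M → 0 < y₂ → y₂ ≤ M →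
        k ≤ (ε - η * x) / (y₁ * y₂) := by
  set η := ε / (2 * M) with hη
  have hη0 : 0 < η := by positivity
  refine ⟨η, min (β * η / M / (σ + η)) (ε / 2 / (M * M)), hη0, by positivity,
    fun y hy hyM => ?_, fun x y₁ y₂ hx hy₁ hy₁M hy₂ hy₂M => ?_⟩
  · calc _ ≤ β * η / M := (le_div_iff₀ (by positivity)).1 (min_le_left _ _)
      _ ≤ β * η / y := by gcongr
  · have hηx : η * x ≤ ε / 2 :=
      (mul_le_mul_of_nonneg_left hx hη0.le).trans_eq (by rw [hη]; field_simp)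
    calc _ ≤ ε / 2 / (M * M) := min_le_right _ _
      _ ≤ ε / 2 / (y₁ * y₂) := by gcongr
      _ ≤ (ε - η * x) / (y₁ * y₂) := by gcongr; linarith

namespace IsPositiveSolutionOn

variable {α γ : ℝ → ℝ} {β σ ε a b : ℝ} {x₁ y₁ x₂ y₂ : ℝ → ℝ}

lemma weighted_dist_le {η k : ℝ} (hβ : 0 ≤ β) (hσ : 0 ≤ σ) (hη : 0 ≤ η)
    (h₁ : IsPositiveSolutionOn α γ β σ ε (Icc a b) x₁ y₁)
    (h₂ : IsPositiveSolutionOn α γ β σ ε (Icc a b) x₂ y₂)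
    (hkx : ∀ t ∈ Icc a b, k * (σ + η) ≤ β * η / y₁ t)
    (hky : ∀ t ∈ Icc a b, k ≤ (ε - η * x₂ t) / (y₁ t * y₂ t)) :
    ∀ t ∈ Icc a b, (σ + η) * |x₁ t - x₂ t| + β * |y₁ t - y₂ t| ≤
      ((σ + η) * |x₁ a - x₂ a| + β * |y₁ a - y₂ a|) * Real.exp (-k * (t - a)) := by
  set D : ℝ → ℝ := fun t => (σ + η) * |x₁ t - x₂ t| + β * |y₁ t - y₂ t| with hD
  have hderiv : ∀ t ∈ Ico a b, ∃ d, HasDerivWithinAt D d (Ici t) t ∧ d ≤ -k * D t + 0 := by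
    intro t ht
    have ht' := Ico_subset_Icc_self ht
    have hnhds := Icc_mem_nhdsGE_of_mem ht
    obtain ⟨s₁, hs₁, hX, hdX⟩ := exists_abs_le_one_hasDerivWithinAt_abs
      (((h₁.deriv_x t ht').sub (h₂.deriv_x t ht')).mono_of_mem_nhdsWithin hnhds)
    obtain ⟨s₂, hs₂, hY, hdY⟩ := exists_abs_le_one_hasDerivWithinAt_abs
      (((h₁.deriv_y t ht').sub (h₂.deriv_y t ht')).mono_of_mem_nhdsWithin hnhds)
    refine ⟨_, (hdX.const_mul (σ + η)).add (hdY.const_mul β), ?_⟩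
    have hdrift := weighted_drift_le (ε := ε) hβ hσ hη (h₁.pos_y t ht') (h₂.pos_x t ht').le
      (h₂.pos_y t ht') hs₁ hs₂ hX hY
    have hrate₁ := mul_le_mul_of_nonneg_right (hkx t ht') (abs_nonneg (x₁ t - x₂ t))
    have hrate₂ := mul_le_mul_of_nonneg_right (mul_le_mul_of_nonneg_left (hky t ht') hβ)
      (abs_nonneg (y₁ t - y₂ t))
    simp only [hD]
    linarith
  have hcont : ContinuousOn D (Icc a b) :=
    ((h₁.continuousOn_x.sub h₂.continuousOn_x).abs.const_mul _).add
      ((h₁.continuousOn_y.sub h₂.continuousOn_y).abs.const_mul _)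
  choose! d hd hdle using hderiv
  intro t ht
  have hgronwall := le_gronwallBound_of_liminf_deriv_right_le hcont
    (fun r hr _ hc => (hd r hr).liminf_right_slope_le hc) le_rfl hdle t ht
  rwa [gronwallBound_ε0] at hgronwall

lemma eqOn (hβ : 0 < β) (hσ : 0 < σ) (hε : 0 ≤ ε)
    (h₁ : IsPositiveSolutionOn α γ β σ ε (Icc a b) x₁ y₁)
    (h₂ : IsPositiveSolutionOn α γ β σ ε (Icc a b) x₂ y₂) (hx : x₁ a = x₂ a) (hy : y₁ a = y₂ a) :
    EqOn x₁ x₂ (Icc a b) ∧ EqOn y₁ y₂ (Icc a b) := by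
  have hdist : ∀ t ∈ Icc a b, σ * |x₁ t - x₂ t| + β * |y₁ t - y₂ t| ≤ 0 := fun t ht => by
    have hrate : ∀ s ∈ Icc a b, 0 ≤ (ε - 0 * x₂ s) / (y₁ s * y₂ s) := fun s hs =>
      div_nonneg (by simpa using hε) (mul_pos (h₁.pos_y s hs) (h₂.pos_y s hs)).le
    simpa [hx, hy] using weighted_dist_le hβ.le hσ.le le_rfl h₁ h₂ (by simp) hrate t ht
  refine ⟨fun t ht => sub_eq_zero.1 (abs_nonpos_iff.1 ?_),
    fun t ht => sub_eq_zero.1 (abs_nonpos_iff.1 ?_)⟩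
  · nlinarith [hdist t ht, mul_nonneg hβ.le (abs_nonneg (y₁ t - y₂ t))]
  · nlinarith [hdist t ht, mul_nonneg hσ.le (abs_nonneg (x₁ t - x₂ t))]

lemma exists_exp_dist_le {M : ℝ} (hβ : 0 < β) (hσ : 0 < σ) (hε : 0 < ε)
    (h₁ : IsPositiveSolutionOn α γ β σ ε (Ici a) x₁ y₁)
    (h₂ : IsPositiveSolutionOn α γ β σ ε (Ici a) x₂ y₂) (hy₁ : ∀ t ∈ Ici a, y₁ t ≤ M)
    (hx₂ : ∀ t ∈ Ici a, x₂ t ≤ M) (hy₂ : ∀ t ∈ Ici a, y₂ t ≤ M) :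
    ∃ C k : ℝ, 0 < k ∧ ∀ t ∈ Ici a, |x₁ t - x₂ t| ≤ C * Real.exp (-k * (t - a)) ∧
      |y₁ t - y₂ t| ≤ C * Real.exp (-k * (t - a)) := by
  have hM : 0 < M := (h₁.pos_y a self_mem_Ici).trans_le (hy₁ a self_mem_Ici)
  obtain ⟨η, k, hη, hk, hkx, hky⟩ := exists_pos_rate hβ hσ.le hε hM
  set D := (σ + η) * |x₁ a - x₂ a| + β * |y₁ a - y₂ a|
  have hdist : ∀ t ∈ Ici a, (σ + η) * |x₁ t - x₂ t| + β * |y₁ t - y₂ t| ≤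
      D * Real.exp (-k * (t - a)) := fun t ht =>
    weighted_dist_le hβ.le hσ.le hη.le (h₁.mono Icc_subset_Ici_self) (h₂.mono Icc_subset_Ici_self)
      (fun s hs => hkx _ (h₁.pos_y s hs.1) (hy₁ s hs.1))
      (fun s hs => hky _ _ _ (hx₂ s hs.1) (h₁.pos_y s hs.1) (hy₁ s hs.1) (h₂.pos_y s hs.1)
        (hy₂ s hs.1)) t ⟨ht, le_rfl⟩
  have hw : 0 < min (σ + η) β := by positivity
  refine ⟨D / min (σ + η) β, k, hk, fun t ht => ?_⟩
  rw [div_mul_eq_mul_div, le_div_iff₀ hw, le_div_iff₀ hw]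
  have hwx := mul_le_mul_of_nonneg_left (min_le_left (σ + η) β) (abs_nonneg (x₁ t - x₂ t))
  have hwy := mul_le_mul_of_nonneg_left (min_le_right (σ + η) β) (abs_nonneg (y₁ t - y₂ t))
  have hX : 0 ≤ (σ + η) * |x₁ t - x₂ t| := by positivity
  have hY : 0 ≤ β * |y₁ t - y₂ t| := by positivity
  constructor <;> linarith [hdist t ht]

end IsPositiveSolutionOn

end Contraction

section Cutoff

/-- The quotient `z.1 / z.2` with its numerator clamped to `[0, M]` and its denominator kept above
`m`. Replacing the quotients of the system by it gives a bounded Lipschitz vector field. -/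
noncomputable def cutoffQuot (M m : ℝ) (z : ℝ × ℝ) : ℝ :=
  max 0 (min z.1 M) / max z.2 m

/-- The autonomous part of the system with both of its quotients cut off; `ε / y` is the cut-off
quotient of the pair `(ε, y)`. -/
noncomputable def cutoffField (β σ ε M m : ℝ) (z : ℝ × ℝ) : ℝ × ℝ :=
  (-(β * cutoffQuot M m z), σ * cutoffQuot M m z + cutoffQuot ε m (ε, z.2))

variable {M m : ℝ}

lemma cutoffQuot_nonneg (hm : 0 ≤ m) (z : ℝ × ℝ) : 0 ≤ cutoffQuot M m z :=
  div_nonneg (le_max_left _ _) (hm.trans (le_max_right _ _))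

lemma abs_cutoffQuot_le (hM : 0 ≤ M) (hm : 0 < m) (z : ℝ × ℝ) : |cutoffQuot M m z| ≤ M / m :=
  (abs_of_nonneg (cutoffQuot_nonneg hm.le z)).trans_le <|
    div_le_div₀ hM (max_le hM (min_le_right _ _)) hm (le_max_right _ _)

lemma cutoffQuot_eq_div {x y : ℝ} (hx : 0 ≤ x) (hxM : x ≤ M) (hy : m ≤ y) :
    cutoffQuot M m (x, y) = x / y := by
  simp [cutoffQuot, hx, hxM, hy]

lemma exists_lipschitzWith_cutoffQuot (hM : 0 ≤ M) (hm : 0 < m) :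
    ∃ K, LipschitzWith K (cutoffQuot M m) := by
  refine ⟨(1 / m + M / m ^ 2).toNNReal, LipschitzWith.of_dist_le' fun z w => ?_⟩
  have hnum : |max 0 (min z.1 M) - max 0 (min w.1 M)| ≤ dist z w :=
    calc _ ≤ |min z.1 M - min w.1 M| := by simpa using abs_max_sub_max_le_max 0 (min z.1 M) 0 _
      _ ≤ |z.1 - w.1| := by simpa using abs_min_sub_min_le_max z.1 M w.1 M
      _ ≤ dist z w := norm_fst_le (z - w)
  have hden : |max z.2 m - max w.2 m| ≤ dist z w :=
    (abs_max_sub_max_le_abs _ _ _).trans (norm_snd_le (z - w))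
  have hM' : |max 0 (min w.1 M)| ≤ M :=
    (abs_of_nonneg (le_max_left _ _)).trans_le (max_le hM (min_le_right _ _))
  calc dist (cutoffQuot M m z) (cutoffQuot M m w)
      ≤ |max 0 (min z.1 M) - max 0 (min w.1 M)| / m + M / m ^ 2 * |max z.2 m - max w.2 m| :=
        abs_div_sub_div_le hm (le_max_right _ _) (le_max_right _ _) hM'
    _ ≤ dist z w / m + M / m ^ 2 * dist z w := by gcongr
    _ = (1 / m + M / m ^ 2) * dist z w := by ring

variable {ε : ℝ} (β σ : ℝ)

lemma exists_lipschitzWith_cutoffField (hM : 0 ≤ M) (hm : 0 < m) (hε : 0 ≤ ε) :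
    ∃ K, LipschitzWith K (cutoffField β σ ε M m) := by
  obtain ⟨K₁, hK₁⟩ := exists_lipschitzWith_cutoffQuot hM hm
  obtain ⟨K₂, hK₂⟩ := exists_lipschitzWith_cutoffQuot hε hm
  exact ⟨_, ((lipschitzWith_smul β).comp hK₁).neg.prodMk <| ((lipschitzWith_smul σ).comp hK₁).add <|
    hK₂.comp ((LipschitzWith.const ε).prodMk LipschitzWith.prod_snd)⟩

lemma norm_cutoffField_le (hM : 0 ≤ M) (hm : 0 < m) (hε : 0 ≤ ε) (z : ℝ × ℝ) :
    ‖cutoffField β σ ε M m z‖ ≤ max (|β| * (M / m)) (|σ| * (M / m) + ε / m) := by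
  have hq := abs_cutoffQuot_le hM hm z
  refine max_le_max ?_ ((abs_add_le _ _).trans (add_le_add ?_ (abs_cutoffQuot_le hε hm _)))
  · refine (norm_neg _).trans_le ?_
    rw [Real.norm_eq_abs, abs_mul]
    gcongr
  · rw [abs_mul]
    gcongr

lemma exists_cutoff_solution {α γ : ℝ → ℝ} {a b : ℝ} (hab : a ≤ b) (hα : ContinuousOn α (Icc a b))
    (hγ : ContinuousOn γ (Icc a b)) (hM : 0 ≤ M) (hm : 0 < m) (hε : 0 ≤ ε) (u₀ v₀ : ℝ) :
    ∃ x y : ℝ → ℝ, x a = u₀ ∧ y a = v₀ ∧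
      (∀ t ∈ Icc a b,
        HasDerivWithinAt x (α t - β * cutoffQuot M m (x t, y t)) (Icc a b) t) ∧
      ∀ t ∈ Icc a b, HasDerivWithinAt y
        (-γ t + σ * cutoffQuot M m (x t, y t) + cutoffQuot ε m (ε, y t)) (Icc a b) t := by
  obtain ⟨K, hK⟩ := exists_lipschitzWith_cutoffField β σ hM hm hε
  obtain ⟨z, hz₀, hz⟩ := exists_hasDerivWithinAt_forcing_add hab (hα.prodMk hγ.neg) hK
    (norm_cutoffField_le β σ hM hm hε) (u₀, v₀)
  refine ⟨fun t => (z t).1, fun t => (z t).2, by simp [hz₀], by simp [hz₀], fun t ht => ?_,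
    fun t ht => ?_⟩
  · exact (ContinuousLinearMap.fst ℝ ℝ ℝ).hasFDerivAt.comp_hasDerivWithinAt t (hz t ht)
  · rw [add_assoc]
    exact (ContinuousLinearMap.snd ℝ ℝ ℝ).hasFDerivAt.comp_hasDerivWithinAt t (hz t ht)

end Cutoff

section Existence

variable {α γ : ℝ → ℝ} {β σ ε c A : ℝ}

-- At the level `m` the term `ε / y` outweighs `γ`, and at the level `n` the forcing `α` outweighs
-- `β * (x / y)`, so a solution of the cut-off system never meets the cutoff.
lemma exists_isPositiveSolutionOn_Icc {m n u₀ v₀ a b : ℝ} (hβ : 0 ≤ β) (hσ : 0 ≤ σ) (hε : 0 ≤ ε)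
    (hα : Continuous α) (hγ : Continuous γ) (hαc : ∀ t, c ≤ α t) (hγA : ∀ t, γ t ≤ A)
    (hm : 0 < m) (hmv : m ≤ v₀) (hmA : A * m < ε) (hn : 0 < n) (hnu : n ≤ u₀)
    (hnc : β * n < c * m) (hab : a ≤ b) :
    ∃ x y : ℝ → ℝ, IsPositiveSolutionOn α γ β σ ε (Icc a b) x y ∧ x a = u₀ ∧ y a = v₀ ∧
      ∀ t ∈ Icc a b, n ≤ x t ∧ m ≤ y t := by
  obtain ⟨B, hB⟩ := isCompact_Icc.exists_bound_of_continuousOn hα.continuousOn (s := Icc a b)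
  have hB₀ : 0 ≤ B := (norm_nonneg _).trans (hB a ⟨le_rfl, hab⟩)
  set M := u₀ + B * (b - a)
  have huM : u₀ ≤ M := le_add_of_nonneg_right (mul_nonneg hB₀ (sub_nonneg.2 hab))
  have hM : 0 ≤ M := by linarith
  obtain ⟨x, y, hx₀, hy₀, hx, hy⟩ := exists_cutoff_solution β σ hab hα.continuousOn
    hγ.continuousOn hM hm hε u₀ v₀
  have hq := cutoffQuot_nonneg (M := M) hm.le
  have hym : ∀ t ∈ Icc a b, m ≤ y t := by
    refine le_of_hasDerivWithinAt_pos_of_eq hy (hy₀ ▸ hmv) fun t _ hyt => ?_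
    have hAm : A < ε / m := (lt_div_iff₀ hm).2 hmA
    rw [cutoffQuot_eq_div hε le_rfl hyt.ge, hyt]
    linarith [hγA t, mul_nonneg hσ (hq (x t, m))]
  have hxM : ∀ t ∈ Icc a b, x t ≤ M := fun t ht =>
    calc x t ≤ x a + B * (t - a) := le_add_mul_sub_of_hasDerivWithinAt_le hx
          (fun s hs => by linarith [le_of_abs_le (hB s hs), mul_nonneg hβ (hq (x s, y s))]) t ht
      _ ≤ u₀ + B * (b - a) := by
          rw [hx₀]
          gcongr
          exact ht.2
  have hxn : ∀ t ∈ Icc a b, n ≤ x t := by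
    refine le_of_hasDerivWithinAt_pos_of_eq hx (hx₀ ▸ hnu) fun t ht hxt => ?_
    have hnm : β * (n / m) < c := by rwa [mul_div_assoc', div_lt_iff₀ hm]
    have hny : β * (n / y t) ≤ β * (n / m) := by gcongr; exact hym t ht
    rw [cutoffQuot_eq_div (hxt ▸ hn.le) (hxM t ht) (hym t ht), hxt]
    linarith [hαc t]
  refine ⟨x, y, ⟨fun t ht => hn.trans_le (hxn t ht), fun t ht => hm.trans_le (hym t ht),
    fun t ht => ?_, fun t ht => ?_⟩, hx₀, hy₀, fun t ht => ⟨hxn t ht, hym t ht⟩⟩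
  · simpa only [cutoffQuot_eq_div (hn.le.trans (hxn t ht)) (hxM t ht) (hym t ht)] using hx t ht
  · simpa only [cutoffQuot_eq_div (hn.le.trans (hxn t ht)) (hxM t ht) (hym t ht),
      cutoffQuot_eq_div hε le_rfl (hym t ht)] using hy t ht

lemma exists_isPositiveSolutionOn_Ici_of_forall_Icc {m n u₀ v₀ a : ℝ} (hβ : 0 < β) (hσ : 0 < σ)
    (hε : 0 ≤ ε)
    (h : ∀ b, a ≤ b → ∃ x y : ℝ → ℝ, IsPositiveSolutionOn α γ β σ ε (Icc a b) x y ∧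
      x a = u₀ ∧ y a = v₀ ∧ ∀ t ∈ Icc a b, n ≤ x t ∧ m ≤ y t) :
    ∃ x y : ℝ → ℝ, IsPositiveSolutionOn α γ β σ ε (Ici a) x y ∧
      x a = u₀ ∧ y a = v₀ ∧ ∀ t ∈ Ici a, n ≤ x t ∧ m ≤ y t := by
  choose! X Y hsol hX hY hlow using h
  have hcompat : ∀ b, a ≤ b → ∀ t ∈ Icc a b, X t t = X b t ∧ Y t t = Y b t := by
    intro b hb t ht
    have heq := (hsol t ht.1).eqOn hβ hσ hε ((hsol b hb).mono (Icc_subset_Icc_right ht.2))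
      ((hX t ht.1).trans (hX b hb).symm) ((hY t ht.1).trans (hY b hb).symm)
    exact ⟨heq.1 ⟨ht.1, le_rfl⟩, heq.2 ⟨ht.1, le_rfl⟩⟩
  exact ⟨fun t => X t t, fun t => Y t t,
    .Ici_of_forall_Icc fun b hb => (hsol b hb).congr (fun t ht => (hcompat b hb t ht).1)
      (fun t ht => (hcompat b hb t ht).2),
    hX a le_rfl, hY a le_rfl, fun t ht => hlow t ht t ⟨ht, le_rfl⟩⟩

lemma exists_isPositiveSolutionOn_Ici {u₀ v₀ : ℝ} (hβ : 0 < β) (hσ : 0 < σ) (hε : 0 < ε)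
    (hα : Continuous α) (hγ : Continuous γ) (hc : 0 < c) (hαc : ∀ t, c ≤ α t) (hA : 0 < A)
    (hγA : ∀ t, γ t ≤ A) (hu₀ : 0 < u₀) (hv₀ : 0 < v₀) (a : ℝ) :
    ∃ x y : ℝ → ℝ, IsPositiveSolutionOn α γ β σ ε (Ici a) x y ∧ x a = u₀ ∧ y a = v₀ ∧
      ∃ m, 0 < m ∧ ∀ t ∈ Ici a, m ≤ x t ∧ m ≤ y t := by
  obtain ⟨m, hm, hm'⟩ := exists_between (show 0 < min v₀ (ε / A) by positivity)
  have hmA : A * m < ε := (lt_div_iff₀' hA).1 (hm'.trans_le (min_le_right _ _))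
  obtain ⟨n, hn, hn'⟩ := exists_between (show 0 < min u₀ (c * m / β) by positivity)
  have hnc : β * n < c * m := (lt_div_iff₀' hβ).1 (hn'.trans_le (min_le_right _ _))
  obtain ⟨x, y, h, hx, hy, hlow⟩ :=
    exists_isPositiveSolutionOn_Ici_of_forall_Icc hβ hσ hε.le fun b hb =>
      exists_isPositiveSolutionOn_Icc hβ.le hσ.le hε.le hα hγ hαc hγA hm
        (hm'.le.trans (min_le_left _ _)) hmA hn (hn'.le.trans (min_le_left _ _)) hnc hb
  exact ⟨x, y, h, hx, hy, min n m, lt_min hn hm, fun t ht =>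
    ⟨(min_le_left _ _).trans (hlow t ht).1, (min_le_right _ _).trans (hlow t ht).2⟩⟩

end Existence

section UpperBound

variable {α γ : ℝ → ℝ} {β σ ε p a : ℝ} {x y : ℝ → ℝ}

lemma exists_sq_add_mul_le {b c δ : ℝ} (hb : 0 ≤ b) (hc : 0 ≤ c) (hδ : 0 < δ) :
    ∃ R, ∀ y, 0 ≤ y → b * (1 + y) ^ 2 + c * y ≤ δ * (y * (1 + y) ^ 2) + R := by
  set K := (b + c) / δ
  have : 0 ≤ K := by positivity
  refine ⟨b * (1 + K) ^ 2 + c * K, fun y hy => ?_⟩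
  rcases le_total y K with hyK | hKy
  · calc b * (1 + y) ^ 2 + c * y ≤ b * (1 + K) ^ 2 + c * K := by gcongr
      _ ≤ _ := le_add_of_nonneg_left (by positivity)
  · have hbc : b + c ≤ δ * y := (div_le_iff₀' hδ).1 hKy
    calc b * (1 + y) ^ 2 + c * y ≤ (b + c) * (1 + y) ^ 2 := by nlinarith [mul_nonneg hc hy]
      _ ≤ δ * y * (1 + y) ^ 2 := by gcongr
      _ = δ * (y * (1 + y) ^ 2) := mul_assoc _ _ _
      _ ≤ _ := le_add_of_nonneg_right (by positivity)

-- `1 / (1 + y)` compensates the term `β * ε / y`, which is unbounded as `y → 0`: its derivative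
-- contributes `-(σ * x + ε) / (y * (1 + y) ^ 2)`.
lemma lyapunov_drift_neg {δ g x y : ℝ} (hy : 0 < y)
    (h : β * ε * (1 + y) ^ 2 + (g + β) * y < δ * (y * (1 + y) ^ 2) + (σ * x + β * y) + ε) :
    β * (ε / y) - δ - (-g + σ * (x / y) + ε / y) / (1 + y) ^ 2 < 0 := by
  have hfrac : β * (ε / y) - δ - (-g + σ * (x / y) + ε / y) / (1 + y) ^ 2 =
      (β * ε * (1 + y) ^ 2 + (g + β) * y -
        (δ * (y * (1 + y) ^ 2) + (σ * x + β * y) + ε)) / (y * (1 + y) ^ 2) := by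
    field_simp
    ring
  rw [hfrac]
  exact div_neg_of_neg_of_pos (sub_neg.2 h) (by positivity)

namespace IsPositiveSolutionOn

lemma exists_mul_add_mul_le (hp : 0 < p) (hβ : 0 ≤ β) (hε : 0 < ε) (hα : Continuous α)
    (hγ : Continuous γ) (hαp : Function.Periodic α p) (hγp : Function.Periodic γ p)
    (hmean : 0 < meanValue p fun t => β * γ t - σ * α t)
    (h : IsPositiveSolutionOn α γ β σ ε (Ici a) x y) :
    ∃ W, ∀ t ∈ Ici a, σ * x t + β * y t ≤ W := by
  have hper : Function.Periodic (fun t => β * γ t - σ * α t) p := fun t => by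
    simp only [hαp t, hγp t]
  obtain ⟨G, hG, C, hC⟩ := exists_bounded_primitive_sub_meanValue hp (by fun_prop) hper
  obtain ⟨A, hA, hγA⟩ := exists_pos_abs_le_of_periodic hp hγ hγp
  set δ := meanValue p fun t => β * γ t - σ * α t
  obtain ⟨R, hR⟩ := exists_sq_add_mul_le (mul_nonneg hβ hε.le) (add_nonneg hA.le hβ) hmean
  set H : ℝ → ℝ := fun t => σ * x t + β * y t + G t + (1 + y t)⁻¹ with hH
  have hinv₀ : ∀ t ∈ Ici a, 0 ≤ (1 + y t)⁻¹ := fun t ht => by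
    have := h.pos_y t ht
    positivity
  have hinv₁ : ∀ t ∈ Ici a, (1 + y t)⁻¹ ≤ 1 := fun t ht =>
    inv_le_one_of_one_le₀ (by linarith [h.pos_y t ht])
  have hH' : ∀ t ∈ Ici a, HasDerivWithinAt H (β * (ε / y t) - δ -
      (-γ t + σ * (x t / y t) + ε / y t) / (1 + y t) ^ 2) (Ici a) t := fun t ht =>
    (((h.hasDerivWithinAt_mul_add_mul ht).add (hG t).hasDerivWithinAt).add
      (((h.deriv_y t ht).const_add 1).fun_inv (by linarith [h.pos_y t ht]))).congr_deriv (by ring)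
  set L := max (H a) (R + C + 1)
  have hHL : ∀ t ∈ Ici a, H t ≤ L := fun t ht =>
    le_of_hasDerivWithinAt_neg_of_eq (fun s hs => (hH' s hs.1).mono Icc_subset_Ici_self)
      (le_max_left _ _) (fun s hs hHs => lyapunov_drift_neg (h.pos_y s hs.1) (by
        have hL : R + C + 1 ≤ H s := hHs ▸ le_max_right _ _
        have hγy := mul_le_mul_of_nonneg_right (le_of_abs_le (hγA s)) (h.pos_y s hs.1).le
        have hRs := hR (y s) (h.pos_y s hs.1).le
        simp only [hH] at hL
        linarith [hinv₁ s hs.1, le_of_abs_le (hC s)])) t ⟨ht, le_rfl⟩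
  refine ⟨L + C, fun t ht => ?_⟩
  have hHt := hHL t ht
  simp only [hH] at hHt
  linarith [hinv₀ t ht, neg_le_of_abs_le (hC t)]

lemma exists_le (hp : 0 < p) (hβ : 0 < β) (hσ : 0 < σ) (hε : 0 < ε) (hα : Continuous α)
    (hγ : Continuous γ) (hαp : Function.Periodic α p) (hγp : Function.Periodic γ p)
    (hmean : 0 < meanValue p fun t => β * γ t - σ * α t)
    (h : IsPositiveSolutionOn α γ β σ ε (Ici a) x y) :
    ∃ M, ∀ t ∈ Ici a, x t ≤ M ∧ y t ≤ M := by
  obtain ⟨W, hW⟩ := h.exists_mul_add_mul_le hp hβ.le hε hα hγ hαp hγp hmean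
  refine ⟨max (W / σ) (W / β), fun t ht => ⟨le_max_of_le_left ?_, le_max_of_le_right ?_⟩⟩
  · rw [le_div_iff₀' hσ]
    linarith [hW t ht, mul_pos hβ (h.pos_y t ht)]
  · rw [le_div_iff₀' hβ]
    linarith [hW t ht, mul_pos hσ (h.pos_x t ht)]

lemma tendsto_sub_zero {u v : ℝ → ℝ} (hp : 0 < p) (hβ : 0 < β) (hσ : 0 < σ) (hε : 0 < ε)
    (hα : Continuous α) (hγ : Continuous γ) (hαp : Function.Periodic α p)
    (hγp : Function.Periodic γ p) (hmean : 0 < meanValue p fun t => β * γ t - σ * α t)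
    (h : IsPositiveSolutionOn α γ β σ ε (Ici a) u v)
    (h' : IsPositiveSolutionOn α γ β σ ε (Ici a) x y) :
    Tendsto (fun t => u t - x t) atTop (𝓝 0) ∧ Tendsto (fun t => v t - y t) atTop (𝓝 0) := by
  obtain ⟨M, hM⟩ := h.exists_le hp hβ hσ hε hα hγ hαp hγp hmean
  obtain ⟨M', hM'⟩ := h'.exists_le hp hβ hσ hε hα hγ hαp hγp hmean
  obtain ⟨C, k, hk, hexp⟩ := h.exists_exp_dist_le (M := max M M') hβ hσ hε h'
    (fun t ht => le_max_of_le_left (hM t ht).2) (fun t ht => le_max_of_le_right (hM' t ht).1)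
    (fun t ht => le_max_of_le_right (hM' t ht).2)
  exact ⟨tendsto_zero_of_norm_le_exp hk fun t ht => (hexp t ht).1,
    tendsto_zero_of_norm_le_exp hk fun t ht => (hexp t ht).2⟩

end IsPositiveSolutionOn

end UpperBound

section PeriodicSolution

variable {α γ : ℝ → ℝ} {β σ ε p : ℝ} {x y X Y : ℝ → ℝ}

lemma tendsto_div_sub_div_zero {l : Filter ℝ} {M m : ℝ} (hm : 0 < m) (hy : ∀ᶠ t in l, m ≤ y t)
    (hY : ∀ t, m ≤ Y t) (hX : ∀ t, |X t| ≤ M) (hxX : Tendsto (fun t => x t - X t) l (𝓝 0))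
    (hyY : Tendsto (fun t => y t - Y t) l (𝓝 0)) :
    Tendsto (fun t => x t / y t - X t / Y t) l (𝓝 0) := by
  refine squeeze_zero_norm' (hy.mono fun t ht => abs_div_sub_div_le hm ht (hY t) (hX t)) ?_
  simpa using (hxX.abs.div_const m).add (hyY.abs.const_mul (M / m ^ 2))

namespace IsPositivePeriodicSolution

lemma of_tendsto_sub {a m M : ℝ} (hp : 0 < p) (hαp : Function.Periodic α p)
    (hγp : Function.Periodic γ p) (h : IsPositiveSolutionOn α γ β σ ε (Ici a) x y) (hm : 0 < m)
    (hx : ∀ t ∈ Ici a, x t ∈ Icc m M) (hy : ∀ t ∈ Ici a, m ≤ y t)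
    (hXp : Function.Periodic X p) (hYp : Function.Periodic Y p)
    (hxX : Tendsto (fun t => x t - X t) atTop (𝓝 0))
    (hyY : Tendsto (fun t => y t - Y t) atTop (𝓝 0)) :
    IsPositivePeriodicSolution α γ β σ ε p X Y := by
  have hyev : ∀ᶠ t in atTop, m ≤ y t := (eventually_ge_atTop a).mono hy
  have hX : ∀ t, X t ∈ Icc m M :=
    mem_of_periodic_of_tendsto_sub isClosed_Icc hp hXp hxX ((eventually_ge_atTop a).mono hx)
  have hY : ∀ t, m ≤ Y t := mem_of_periodic_of_tendsto_sub isClosed_Ici hp hYp hyY hyev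
  have hXabs : ∀ t, |X t| ≤ M := fun t =>
    (abs_of_pos (hm.trans_le (hX t).1)).trans_le (hX t).2
  have hquot := tendsto_div_sub_div_zero hm hyev hY hXabs hxX hyY
  have hεquot := tendsto_div_sub_div_zero (x := fun _ => ε) (X := fun _ => ε) hm hyev hY
    (fun _ => le_rfl) (by simp) hyY
  have hX' : ∀ t, HasDerivAt X (α t - β * (X t / Y t)) t := by
    refine hasDerivAt_of_periodic_of_tendsto_sub hp hXp
      (fun t => by simp only [hαp t, hXp t, hYp t])
      ((eventually_gt_atTop a).mono fun t ht => (h.deriv_x t ht.le).hasDerivAt (Ici_mem_nhds ht))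
      hxX ?_
    convert hquot.const_mul (-β) using 2 <;> ring
  have hY' : ∀ t, HasDerivAt Y (-γ t + σ * (X t / Y t) + ε / Y t) t := by
    refine hasDerivAt_of_periodic_of_tendsto_sub hp hYp
      (fun t => by simp only [hγp t, hXp t, hYp t])
      ((eventually_gt_atTop a).mono fun t ht => (h.deriv_y t ht.le).hasDerivAt (Ici_mem_nhds ht))
      hyY ?_
    convert (hquot.const_mul σ).add hεquot using 2 <;> ring
  exact ⟨⟨fun t _ => hm.trans_le (hX t).1, fun t _ => hm.trans_le (hY t),
    fun t _ => (hX' t).hasDerivWithinAt, fun t _ => (hY' t).hasDerivWithinAt⟩, hXp, hYp⟩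

lemma exists_of_meanValue_pos {c : ℝ} (hp : 0 < p) (hβ : 0 < β) (hσ : 0 < σ) (hε : 0 < ε)
    (hα : Continuous α) (hγ : Continuous γ) (hαp : Function.Periodic α p)
    (hγp : Function.Periodic γ p) (hc : 0 < c) (hαc : ∀ t, c ≤ α t)
    (hmean : 0 < meanValue p fun t => β * γ t - σ * α t) :
    ∃ X Y : ℝ → ℝ, IsPositivePeriodicSolution α γ β σ ε p X Y := by
  obtain ⟨A, hA, hγA⟩ := exists_pos_abs_le_of_periodic hp hγ hγp
  obtain ⟨x, y, h, -, -, m, hm, hlow⟩ := exists_isPositiveSolutionOn_Ici hβ hσ hε hα hγ hc hαc hA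
    (fun t => le_of_abs_le (hγA t)) one_pos one_pos 0
  obtain ⟨M, hM⟩ := h.exists_le hp hβ hσ hε hα hγ hαp hγp hmean
  have hmaps : MapsTo (· + p) (Ici (0 : ℝ)) (Ici 0) := fun t ht => add_nonneg ht hp.le
  obtain ⟨C, k, hk, hexp⟩ := (h.comp_add_const hαp hγp hmaps).exists_exp_dist_le hβ hσ hε h
    (fun t ht => (hM _ (hmaps ht)).2) (fun t ht => (hM t ht).1) (fun t ht => (hM t ht).2)
  simp only [sub_zero] at hexp
  obtain ⟨X, hXp, hxX⟩ :=
    exists_periodic_tendsto_sub_of_exp_bound (f := x) hp hk fun t ht => (hexp t ht).1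
  obtain ⟨Y, hYp, hyY⟩ :=
    exists_periodic_tendsto_sub_of_exp_bound (f := y) hp hk fun t ht => (hexp t ht).2
  exact ⟨X, Y, of_tendsto_sub hp hαp hγp h hm (fun t ht => ⟨(hlow t ht).1, (hM t ht).1⟩)
    (fun t ht => (hlow t ht).2) hXp hYp hxX hyY⟩

lemma meanValue_pos (hp : 0 < p) (hβ : 0 < β) (hε : 0 < ε) (hα : Continuous α)
    (hγ : Continuous γ) (h : IsPositivePeriodicSolution α γ β σ ε p x y) :
    0 < meanValue p fun t => β * γ t - σ * α t := by
  have hyc : Continuous y := continuousOn_univ.1 h.solution.continuousOn_y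
  have hy₀ : ∀ t, y t ≠ 0 := fun t => (h.solution.pos_y t (mem_univ t)).ne'
  have hpull : IntervalIntegrable (fun t => β * (ε / y t)) MeasureTheory.volume 0 p :=
    (by fun_prop (disch := exact hy₀ _) : Continuous _).intervalIntegrable _ _
  have hdrift : IntervalIntegrable (fun t => β * γ t - σ * α t) MeasureTheory.volume 0 p :=
    (by fun_prop : Continuous _).intervalIntegrable _ _
  have hbalance := intervalIntegral.integral_eq_sub_of_hasDerivAt
    (fun t _ => (h.solution.hasDerivWithinAt_mul_add_mul (mem_univ t)).hasDerivAt univ_mem)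
    (hpull.sub hdrift)
  rw [intervalIntegral.integral_sub hpull hdrift, h.periodic_x.eq, h.periodic_y.eq, sub_self,
    sub_eq_zero] at hbalance
  rw [meanValue, ← hbalance]
  exact mul_pos (one_div_pos.2 hp) <| intervalIntegral.intervalIntegral_pos_of_pos hpull
    (fun t => mul_pos hβ (div_pos hε (h.solution.pos_y t (mem_univ t)))) hp

end IsPositivePeriodicSolution

end PeriodicSolution

theorem theorem2_general (p β σ ε : ℝ) (hp : 0 < p) (hβ : 0 < β) (hσ : 0 < σ) (hε : 0 < ε)
    (α γ : ℝ → ℝ) (hα_cont : Continuous α) (hγ_cont : Continuous γ)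
    (hα_per : Function.Periodic α p) (hγ_per : Function.Periodic γ p) (hα_pos : ∀ t, 0 < α t) :
    ((∃ x y : ℝ → ℝ, IsPositivePeriodicSolution α γ β σ ε p x y) ↔
      0 < β * meanValue p γ - σ * meanValue p α) ∧
    (0 < β * meanValue p γ - σ * meanValue p α →
      ∃ x y : ℝ → ℝ, IsPositivePeriodicSolution α γ β σ ε p x y ∧
        (∀ u v : ℝ → ℝ, IsPositivePeriodicSolution α γ β σ ε p u v → u = x ∧ v = y) ∧
        (∀ t₀ u₀ v₀ : ℝ, 0 < u₀ → 0 < v₀ →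
          ∃ u v : ℝ → ℝ, IsPositiveSolutionOn α γ β σ ε (Ici t₀) u v ∧ u t₀ = u₀ ∧ v t₀ = v₀) ∧
        (∀ (t₀ : ℝ) (u v : ℝ → ℝ), IsPositiveSolutionOn α γ β σ ε (Ici t₀) u v →
          Tendsto (fun t => u t - x t) atTop (𝓝 0) ∧
          Tendsto (fun t => v t - y t) atTop (𝓝 0))) := by
  rw [mul_meanValue_sub_mul_meanValue (hγ_cont.intervalIntegrable _ _)
    (hα_cont.intervalIntegrable _ _)]
  obtain ⟨c, hc, hαc⟩ := exists_pos_le_of_periodic hp hα_cont hα_per hα_pos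
  obtain ⟨A, hA, hγA⟩ := exists_pos_abs_le_of_periodic hp hγ_cont hγ_per
  have hexists := IsPositivePeriodicSolution.exists_of_meanValue_pos hp hβ hσ hε hα_cont hγ_cont
    hα_per hγ_per hc hαc
  refine ⟨⟨fun ⟨x, y, h⟩ => h.meanValue_pos hp hβ hε hα_cont hγ_cont, hexists⟩, fun hmean => ?_⟩
  obtain ⟨x, y, h⟩ := hexists hmean
  have hattracts : ∀ (t₀ : ℝ) (u v : ℝ → ℝ), IsPositiveSolutionOn α γ β σ ε (Ici t₀) u v →
      Tendsto (fun t => u t - x t) atTop (𝓝 0) ∧ Tendsto (fun t => v t - y t) atTop (𝓝 0) :=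
    fun _ _ _ huv => huv.tendsto_sub_zero hp hβ hσ hε hα_cont hγ_cont hα_per hγ_per hmean
      (h.solution.mono (subset_univ _))
  refine ⟨x, y, h, fun u v huv => ?_, fun t₀ u₀ v₀ hu₀ hv₀ => ?_, hattracts⟩
  · obtain ⟨hux, hvy⟩ := hattracts 0 u v (huv.solution.mono (subset_univ _))
    exact ⟨eq_of_periodic_of_tendsto_sub hp huv.periodic_x h.periodic_x hux,
      eq_of_periodic_of_tendsto_sub hp huv.periodic_y h.periodic_y hvy⟩
  · obtain ⟨u, v, huv, hu, hv, -⟩ := exists_isPositiveSolutionOn_Ici hβ hσ hε hα_cont hγ_cont hc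
      hαc hA (fun t => le_of_abs_le (hγA t)) hu₀ hv₀ t₀
    exact ⟨u, v, huv, hu, hv⟩

theorem theorem2 (p β σ ε : ℝ) (hp : 0 < p) (hβ : 0 < β) (hσ : 0 < σ) (hε : 0 < ε)
    (α γ : ℝ → ℝ) (hα_cont : Continuous α) (hγ_cont : Continuous γ)
    (hα_per : Function.Periodic α p) (hγ_per : Function.Periodic γ p)
    (hα_pos : ∀ t, 0 < α t) (hγ_pos : ∀ t, 0 < γ t) :
    ((∃ x y : ℝ → ℝ, IsPositivePeriodicSolution α γ β σ ε p x y) ↔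
      0 < β * meanValue p γ - σ * meanValue p α) ∧
    (0 < β * meanValue p γ - σ * meanValue p α →
      ∃ x y : ℝ → ℝ, IsPositivePeriodicSolution α γ β σ ε p x y ∧
        (∀ u v : ℝ → ℝ, IsPositivePeriodicSolution α γ β σ ε p u v → u = x ∧ v = y) ∧
        (∀ t₀ u₀ v₀ : ℝ, 0 < u₀ → 0 < v₀ →
          ∃ u v : ℝ → ℝ, IsPositiveSolutionOn α γ β σ ε (Ici t₀) u v ∧ u t₀ = u₀ ∧ v t₀ = v₀) ∧
        (∀ (t₀ : ℝ) (u v : ℝ → ℝ), IsPositiveSolutionOn α γ β σ ε (Ici t₀) u v →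
          Tendsto (fun t => u t - x t) atTop (𝓝 0) ∧
          Tendsto (fun t => v t - y t) atTop (𝓝 0))) :=
  theorem2_general p β σ ε hp hβ hσ hε α γ hα_cont hγ_cont hα_per hγ_per hα_pos
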